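/- Let $n\in\mathbb N$, let $f:\mathbb R^n\to\mathbb R$ be of class $C^2$, and let $M:\mathbb R^n\to\mathbb R^{n\times n}$ be a Riemannian metric of class $C^1$ (each entry $M_{ij}$ is $C^1$) that is uniformly symmetric positive definite: every $M(x)$ is symmetric and there is a constant $\beta>0$ with $M(x)\succeq\beta I$ for all $x\in\mathbb R^n$. The Riemannian Hessian of $f$ in the metric $M$ is the symmetric matrix $H(x)$ with entries \[ H_{ij}=\frac{\partial^2 f}{\partial x_i\,\partial x_j}-\sum_{k=1}^n\Gamma_{ij}^k\,\frac{\partial f}{\partial x_k}, \qquad \Gamma_{ij}^m=\frac12\sum_{k=1}^n (M^{-1})_{mk}\left(\frac{\partial M_{ik}}{\partial x_j}+\frac{\partial M_{jk}}{\partial x_i}-\frac{\partial M_{ij}}{\partial x_k}\right). \] If $H(x)$ is positive semidefinite for every $x\in\mathbb R^n$, then every stationary point of $f$ is a global minimizer of $f$: if $\nabla f(x)=0$, then $f(x)\le f(y)$ for all $y\in\mathbb R^n$. -/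

import Mathlib

namespace NatGradContraction

/-- The partial derivative `∂g/∂xᵢ` at `x`. -/
noncomputable def partialDeriv {n : ℕ} (i : Fin n) (g : EuclideanSpace ℝ (Fin n) → ℝ)
    (x : EuclideanSpace ℝ (Fin n)) : ℝ :=
  fderiv ℝ g x (EuclideanSpace.single i 1)

/-- The Christoffel symbol of the second kind
`Γᵢⱼᵐ = ½ ∑ₖ Mᵐᵏ (∂Mᵢₖ/∂xⱼ + ∂Mⱼₖ/∂xᵢ - ∂Mᵢⱼ/∂xₖ)` of the metric `M`,
where `Mᵐᵏ` are the entries of the inverse matrix. -/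
noncomputable def christoffel {n : ℕ}
    (M : EuclideanSpace ℝ (Fin n) → Matrix (Fin n) (Fin n) ℝ)
    (m i j : Fin n) (x : EuclideanSpace ℝ (Fin n)) : ℝ :=
  (1 / 2 : ℝ) * ∑ k : Fin n, (M x)⁻¹ m k *
    (partialDeriv j (fun y => M y i k) x + partialDeriv i (fun y => M y j k) x
      - partialDeriv k (fun y => M y i j) x)

/-- The Riemannian Hessian `Hᵢⱼ = ∂²f/∂xᵢ∂xⱼ - ∑ₖ Γᵢⱼᵏ ∂f/∂xₖ` of `f` in the metric `M`. -/
noncomputable def riemannianHessian {n : ℕ}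
    (M : EuclideanSpace ℝ (Fin n) → Matrix (Fin n) (Fin n) ℝ)
    (f : EuclideanSpace ℝ (Fin n) → ℝ) (x : EuclideanSpace ℝ (Fin n)) :
    Matrix (Fin n) (Fin n) ℝ :=
  Matrix.of fun i j =>
    partialDeriv i (partialDeriv j f) x - ∑ k : Fin n, christoffel M k i j x * partialDeriv k f x

/-- `M` is uniformly symmetric positive definite: every `M x` is symmetric, and
`M x ⪰ β I` for all `x`, with one constant `β > 0`. -/
def IsUniformlyPosDef {n : ℕ}
    (M : EuclideanSpace ℝ (Fin n) → Matrix (Fin n) (Fin n) ℝ) : Prop :=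
  (∀ x, (M x).IsSymm) ∧
    ∃ β : ℝ, 0 < β ∧ ∀ x, (M x - β • (1 : Matrix (Fin n) (Fin n) ℝ)).PosSemidef

/-- `x` is a stationary point of `f`: all first partial derivatives vanish at `x`. -/
def IsStationaryPoint {n : ℕ} (f : EuclideanSpace ℝ (Fin n) → ℝ)
    (x : EuclideanSpace ℝ (Fin n)) : Prop :=
  ∀ i : Fin n, partialDeriv i f x = 0

end NatGradContraction

/-! ### First-order estimates for one Euler step. -/

section

open Filter Topology Set

/-! Let B be the bilinear form of M and V the gradient of f with respect to B. The Lie derivative of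
B along V is twice the Riemannian Hessian (`two_mul_riemannianHessian_apply`), so to first order a
step along -V does not lengthen tangent vectors. Neither geodesics nor the exact flow is needed: the
segment from x to y is pushed by Euler steps p ↦ p - h V p.

The point x is fixed by the steps, the energies of the curves stay bounded
(`exists_forall_metric_le`), and B ≥ β keeps all curves in one ball, on which f is bounded
(`exists_deriv_iterate_sub_smul`). Each step lowers f by about h B(V, V), so these losses have a
bounded sum, however long the total time T = N h. Along a curve f varies at rate B(V, γ'), which
Young's inequality splits into c B(V, V) and a small multiple of the energy. Averaged over the N
curves, with T large, this contradicts f y < f x. -/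

/-- Compactness gives one time interval on which `D h x < D 0 x + ε` for all x in K; the mean value
inequality does the rest. -/
theorem exists_forall_le_add_mul_of_hasDerivAt {X : Type*} [TopologicalSpace X] {K : Set X}
    (hK : IsCompact K) (G D : ℝ → X → ℝ) (hD : Continuous fun z : ℝ × X => D z.1 z.2)
    (hG : ∀ x h, HasDerivAt (fun t => G t x) (D h x) h) {ε : ℝ} (hε : 0 < ε) :
    ∃ h₀ > 0, ∀ h ∈ Icc 0 h₀, ∀ x ∈ K, G h x ≤ G 0 x + h * (D 0 x + ε) := by
  have h1 : ∀ᶠ h in 𝓝 (0 : ℝ), ∀ x ∈ K, D h x < D 0 x + ε := by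
    refine hK.eventually_forall_of_forall_eventually fun x _ => ?_
    have c1 : Continuous fun z : ℝ × X => D 0 z.2 + ε :=
      (hD.comp (continuous_const.prodMk continuous_snd)).add continuous_const
    exact hD.continuousAt.eventually_lt c1.continuousAt (by simpa using hε)
  obtain ⟨r, hr, hball⟩ := Metric.eventually_nhds_iff_ball.1 h1
  refine ⟨r / 2, half_pos hr, fun h hh x hx => ?_⟩
  have key := (convex_Icc 0 h).image_sub_le_mul_sub_of_deriv_le (f := fun t => G t x)
    (C := D 0 x + ε) (fun t _ => (hG x t).continuousAt.continuousWithinAt)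
    (fun t _ => (hG x t).differentiableAt.differentiableWithinAt)
    (fun t ht => by
      rw [(hG x t).deriv]
      rw [interior_Icc] at ht
      refine (hball t ?_ x hx).le
      rw [Metric.mem_ball, Real.dist_eq, sub_zero, abs_of_pos ht.1]
      linarith [ht.2, hh.2])
    0 ⟨le_rfl, hh.1⟩ h ⟨hh.1, le_rfl⟩ hh.1
  simp only [sub_zero] at key
  linarith

variable {E : Type*} [NormedAddCommGroup E] [NormedSpace ℝ E]

theorem exists_forall_comp_sub_smul_le {K : Set E} (hK : IsCompact K) {f : E → ℝ} {V : E → E}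
    (hf : ContDiff ℝ 1 f) (hV : Continuous V) {ε : ℝ} (hε : 0 < ε) :
    ∃ h₀ > 0, ∀ h ∈ Icc 0 h₀, ∀ p ∈ K,
      f (p - h • V p) ≤ f p + h * (-(fderiv ℝ f p (V p)) + ε) := by
  have hf' : Continuous (fderiv ℝ f) := hf.continuous_fderiv one_ne_zero
  obtain ⟨h₀, hpos, H⟩ := exists_forall_le_add_mul_of_hasDerivAt hK
    (fun h p => f (p - h • V p)) (fun h p => fderiv ℝ f (p - h • V p) (-(V p)))
    (by fun_prop) (fun p h => by
      have h1 : HasDerivAt (fun t : ℝ => p - t • V p) (-(V p)) h := by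
        simpa using ((hasDerivAt_id h).smul_const (V p)).const_sub p
      exact ((hf.differentiable one_ne_zero) _).hasFDerivAt.comp_hasDerivAt h h1) hε
  exact ⟨h₀, hpos, fun h hh p hp => by simpa using H h hh p hp⟩

set_option maxSynthPendingDepth 6 in
-- At h = 0 the left side has derivative minus the Lie derivative in `hLie`, hence at most 0.
-- Compactness of K times the unit sphere makes the estimate uniform; homogeneity extends it to all
-- w.
theorem exists_forall_metric_le [ProperSpace E] {K : Set E} (hK : IsCompact K)
    {B : E → E →L[ℝ] E →L[ℝ] ℝ} {V : E → E} (hB : ContDiff ℝ 1 B) (hV : ContDiff ℝ 1 V)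
    (hsymm : ∀ p u w, B p u w = B p w u) {β : ℝ} (hβ : 0 < β)
    (hcoer : ∀ p w, β * ‖w‖ ^ 2 ≤ B p w w)
    (hLie : ∀ p w, 0 ≤ 2 * B p w (fderiv ℝ V p w) + fderiv ℝ B p (V p) w w)
    {ε : ℝ} (hε : 0 < ε) :
    ∃ h₀ > 0, ∀ h ∈ Icc 0 h₀, ∀ p ∈ K, ∀ w,
      B (p - h • V p) (w - h • fderiv ℝ V p w) (w - h • fderiv ℝ V p w)
        ≤ (1 + ε * h) * B p w w := by
  have hB' : Continuous (fderiv ℝ B) := hB.continuous_fderiv one_ne_zero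
  have hV' : Continuous (fderiv ℝ V) := hV.continuous_fderiv one_ne_zero
  have hBc := hB.continuous
  have hVc := hV.continuous
  obtain ⟨h₀, hpos, H⟩ := exists_forall_le_add_mul_of_hasDerivAt
    (hK.prod (isCompact_sphere (0 : E) 1))
    (fun h z => B (z.1 - h • V z.1) (z.2 - h • fderiv ℝ V z.1 z.2)
      (z.2 - h • fderiv ℝ V z.1 z.2))
    (fun h z => (fderiv ℝ B (z.1 - h • V z.1) (-(V z.1)) (z.2 - h • fderiv ℝ V z.1 z.2)
        + B (z.1 - h • V z.1) (-(fderiv ℝ V z.1 z.2))) (z.2 - h • fderiv ℝ V z.1 z.2)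
      + B (z.1 - h • V z.1) (z.2 - h • fderiv ℝ V z.1 z.2) (-(fderiv ℝ V z.1 z.2)))
    (by fun_prop) (fun z h => by
      have h1 : HasDerivAt (fun t : ℝ => z.1 - t • V z.1) (-(V z.1)) h := by
        simpa using ((hasDerivAt_id h).smul_const (V z.1)).const_sub z.1
      have h2 : HasDerivAt (fun t : ℝ => z.2 - t • fderiv ℝ V z.1 z.2)
          (-(fderiv ℝ V z.1 z.2)) h := by
        simpa using ((hasDerivAt_id h).smul_const (fderiv ℝ V z.1 z.2)).const_sub z.2
      have h3 := ((hB.differentiable one_ne_zero) (z.1 - h • V z.1)).hasFDerivAt.comp_hasDerivAt h h1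
      exact (h3.clm_apply h2).clm_apply h2) (mul_pos hε hβ)
  refine ⟨h₀, hpos, fun h hh p hp w => ?_⟩
  -- The additive slack was chosen as ε β: since β ≤ B(u, u) on unit vectors, it becomes the
  -- relative error ε.
  have unit : ∀ u : E, ‖u‖ = 1 →
      B (p - h • V p) (u - h • fderiv ℝ V p u) (u - h • fderiv ℝ V p u)
        ≤ (1 + ε * h) * B p u u := by
    intro u hu
    have h1 := H h hh (p, u) ⟨hp, by simpa using hu⟩
    have h2 := hLie p u
    have h3 := hcoer p u
    rw [hu] at h3
    simp only [zero_smul, sub_zero, map_neg, neg_apply,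
      add_apply] at h1
    rw [hsymm p (fderiv ℝ V p u) u] at h1
    have h4 : h * (-(fderiv ℝ B p (V p) u u) + -(B p u (fderiv ℝ V p u))
        + -(B p u (fderiv ℝ V p u)) + ε * β) ≤ h * (ε * B p u u) :=
      mul_le_mul_of_nonneg_left (by nlinarith) hh.1
    linarith
  rcases eq_or_ne w 0 with rfl | hw
  · simp
  · have hn : ‖w‖ ≠ 0 := norm_ne_zero_iff.2 hw
    have h1 := unit (‖w‖⁻¹ • w) (by rw [norm_smul, norm_inv, norm_norm, inv_mul_cancel₀ hn])
    have h2 : ‖w‖⁻¹ • w - h • fderiv ℝ V p (‖w‖⁻¹ • w)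
        = ‖w‖⁻¹ • (w - h • fderiv ℝ V p w) := by
      rw [map_smul, smul_sub, smul_comm]
    rw [h2] at h1
    simp only [map_smul, smul_apply, smul_eq_mul] at h1
    have h3 : 0 < ‖w‖⁻¹ * ‖w‖⁻¹ := by positivity
    refine le_of_mul_le_mul_left ?_ h3
    linarith

/-! ### Pushed curves and the minimization argument. -/

/-- Young's inequality: expand b at 2c u + w and divide by 4c. -/
theorem neg_apply_le_of_nonneg {b : E →L[ℝ] E →L[ℝ] ℝ} (hsymm : ∀ u w, b u w = b w u)
    (hnonneg : ∀ w, 0 ≤ b w w) (u w : E) {c : ℝ} (hc : 0 < c) :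
    -(b u w) ≤ c * b u u + b w w / (4 * c) := by
  have h := hnonneg ((2 * c) • u + w)
  simp only [map_add, map_smul, add_apply, smul_apply,
    smul_eq_mul] at h
  rw [hsymm w u] at h
  have h2 : c * b u u + b w w / (4 * c) + b u w
      = (4 * c ^ 2 * b u u + 4 * c * b u w + b w w) / (4 * c) := by
    field_simp
    ring
  have h3 : 0 ≤ (4 * c ^ 2 * b u u + 4 * c * b u w + b w w) / (4 * c) := by
    apply div_nonneg _ (by positivity)
    nlinarith
  linarith

theorem dist_le_of_metric_deriv_le {B : E → E →L[ℝ] E →L[ℝ] ℝ} {β : ℝ} (hβ : 0 < β)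
    (hcoer : ∀ p w, β * ‖w‖ ^ 2 ≤ B p w w) {γ γ' : ℝ → E}
    (hγ : ∀ s, HasDerivAt γ (γ' s) s) {A : ℝ}
    (hA : ∀ s ∈ Icc (0 : ℝ) 1, B (γ s) (γ' s) (γ' s) ≤ A) {s : ℝ} (hs : s ∈ Icc (0 : ℝ) 1) :
    dist (γ s) (γ 0) ≤ √(A / β) := by
  have h1 := norm_image_sub_le_of_norm_deriv_le_segment' (f := γ) (f' := γ') (a := 0) (b := 1)
    (C := √(A / β)) (fun t _ => (hγ t).hasDerivWithinAt) (fun t ht => by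
      apply Real.le_sqrt_of_sq_le
      rw [le_div_iff₀ hβ]
      linarith [hcoer (γ t) (γ' t), hA t ⟨ht.1, ht.2.le⟩]) s hs
  rw [dist_eq_norm]
  refine h1.trans ?_
  have : 0 ≤ √(A / β) := Real.sqrt_nonneg _
  nlinarith [hs.1, hs.2]

set_option maxSynthPendingDepth 6 in
-- A bootstrap: the energy bound on the whole k-th curve, which starts at x, keeps it in the ball;
-- there `hstep` applies and bounds the energy of the next curve.
theorem exists_deriv_iterate_sub_smul {B : E → E →L[ℝ] E →L[ℝ] ℝ} {V : E → E}
    (hV : ContDiff ℝ 1 V) {β : ℝ} (hβ : 0 < β) (hcoer : ∀ p w, β * ‖w‖ ^ 2 ≤ B p w w)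
    {x : E} (hx : V x = 0) (y : E) {A : ℝ}
    (hA : ∀ s ∈ Icc (0 : ℝ) 1, B (x + s • (y - x)) (y - x) (y - x) ≤ A) {a h : ℝ} (ha : 0 ≤ a)
    {N : ℕ} (haN : (1 + a) ^ N ≤ 4)
    (hstep : ∀ p ∈ Metric.closedBall x √(4 * A / β), ∀ w,
      B (p - h • V p) (w - h • fderiv ℝ V p w) (w - h • fderiv ℝ V p w) ≤ (1 + a) * B p w w) :
    ∃ γ' : ℕ → ℝ → E, ∀ k ≤ N,
      (fun p => p - h • V p)^[k] x = x ∧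
      (∀ s, HasDerivAt (fun s : ℝ => (fun p => p - h • V p)^[k] (x + s • (y - x))) (γ' k s) s) ∧
      ∀ s ∈ Icc (0 : ℝ) 1,
        (fun p => p - h • V p)^[k] (x + s • (y - x)) ∈ Metric.closedBall x √(4 * A / β) ∧
        B ((fun p => p - h • V p)^[k] (x + s • (y - x))) (γ' k s) (γ' k s) ≤ 4 * A := by
  set Φ : E → E := fun p => p - h • V p with hΦ
  have hBnn : ∀ p w, 0 ≤ B p w w := fun p w => le_trans (by positivity) (hcoer p w)
  have hAnn : 0 ≤ A := (hBnn _ _).trans (hA 0 ⟨le_rfl, zero_le_one⟩)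
  -- Tangent vectors are transported by the derivative of the step.
  let γ' : ℕ → ℝ → E := fun k s =>
    k.rec (y - x) fun k w => w - h • fderiv ℝ V (Φ^[k] (x + s • (y - x))) w
  have hfix : ∀ k, Φ^[k] x = x := fun k => Function.iterate_fixed (by simp [hΦ, hx]) k
  have hder : ∀ k s, HasDerivAt (fun s : ℝ => Φ^[k] (x + s • (y - x))) (γ' k s) s := by
    intro k
    induction k with
    | zero =>
      intro s
      simpa [γ'] using ((hasDerivAt_id s).smul_const (y - x)).const_add x
    | succ k ih =>
      intro s
      simp only [Function.iterate_succ_apply']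
      exact (ih s).sub
        (((hV.differentiable one_ne_zero _).hasFDerivAt.comp_hasDerivAt s (ih s)).const_smul h)
  have hpow : ∀ k ≤ N, (1 + a) ^ k * A ≤ 4 * A := fun k hk =>
    mul_le_mul_of_nonneg_right ((pow_le_pow_right₀ (by linarith) hk).trans haN) hAnn
  have hball : ∀ k, (∀ s ∈ Icc (0 : ℝ) 1,
      B (Φ^[k] (x + s • (y - x))) (γ' k s) (γ' k s) ≤ 4 * A) → ∀ s ∈ Icc (0 : ℝ) 1,
      Φ^[k] (x + s • (y - x)) ∈ Metric.closedBall x √(4 * A / β) := by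
    intro k hk s hs
    have := dist_le_of_metric_deriv_le hβ hcoer (hder k) hk hs
    simpa [hfix] using this
  have hmain : ∀ k ≤ N, ∀ s ∈ Icc (0 : ℝ) 1,
      B (Φ^[k] (x + s • (y - x))) (γ' k s) (γ' k s) ≤ (1 + a) ^ k * A := by
    intro k
    induction k with
    | zero => intro _ s hs; simpa [γ'] using hA s hs
    | succ k ih =>
      intro hk s hs
      have ih' := ih (Nat.le_of_succ_le hk)
      have hmem := hball k (fun s hs => (ih' s hs).trans (hpow k (Nat.le_of_succ_le hk))) s hs
      rw [Function.iterate_succ_apply', pow_succ', mul_assoc]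
      exact (hstep _ hmem (γ' k s)).trans (mul_le_mul_of_nonneg_left (ih' s hs) (by linarith))
  refine ⟨γ', fun k hk => ⟨hfix k, hder k, fun s hs => ?_⟩⟩
  have hle : ∀ s ∈ Icc (0 : ℝ) 1, B (Φ^[k] (x + s • (y - x))) (γ' k s) (γ' k s) ≤ 4 * A :=
    fun s hs => (hmain k hk s hs).trans (hpow k hk)
  exact ⟨hball k hle s hs, hle s hs⟩

/-- A stationary point of a function whose gradient field `V`, with respect to a uniformly positive
definite metric `B`, expands the metric infinitesimally, is a global minimizer. -/
theorem le_of_fderiv_eq_zero_of_lieDeriv_nonneg [ProperSpace E]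
    {B : E → E →L[ℝ] E →L[ℝ] ℝ} {V : E → E} {f : E → ℝ}
    (hB : ContDiff ℝ 1 B) (hV : ContDiff ℝ 1 V) (hf : ContDiff ℝ 1 f)
    (hsymm : ∀ p u w, B p u w = B p w u) {β : ℝ} (hβ : 0 < β)
    (hcoer : ∀ p w, β * ‖w‖ ^ 2 ≤ B p w w)
    (hgrad : ∀ p w, fderiv ℝ f p w = B p (V p) w)
    (hLie : ∀ p w, 0 ≤ 2 * B p w (fderiv ℝ V p w) + fderiv ℝ B p (V p) w w)
    {x : E} (hx : fderiv ℝ f x = 0) (y : E) : f x ≤ f y := by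
  by_contra! hlt
  obtain ⟨δ, hδ⟩ : ∃ δ, δ = f x - f y := ⟨_, rfl⟩
  have hδpos : 0 < δ := by linarith
  have hBc := hB.continuous
  have hBnn : ∀ p w, 0 ≤ B p w w := fun p w => le_trans (by positivity) (hcoer p w)
  have hVx : V x = 0 := by
    have h1 := hcoer x (V x)
    rw [← hgrad, hx, zero_apply] at h1
    have h2 : ‖V x‖ ^ 2 ≤ 0 := by
      by_contra! h
      nlinarith
    exact norm_eq_zero.1 (pow_eq_zero_iff two_ne_zero |>.1 (le_antisymm h2 (by positivity)))
  obtain ⟨A, hApos, hA⟩ : ∃ A > 0, ∀ s ∈ Icc (0 : ℝ) 1,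
      B (x + s • (y - x)) (y - x) (y - x) ≤ A := by
    obtain ⟨C, hC⟩ := (isCompact_Icc (a := (0 : ℝ)) (b := 1)).bddAbove_image
      (f := fun s : ℝ => B (x + s • (y - x)) (y - x) (y - x)) (by fun_prop)
    exact ⟨max C 1, by positivity, fun s hs => (hC ⟨s, hs, rfl⟩).trans (le_max_left _ _)⟩
  have hK : IsCompact (Metric.closedBall x √(4 * A / β)) := isCompact_closedBall _ _
  obtain ⟨F, hF⟩ := hK.exists_bound_of_continuousOn hf.continuous.continuousOn
  -- With this c the energy term of Young's inequality, 4A / (4c), is δ / 4.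
  obtain ⟨c, hc⟩ : ∃ c, c = 4 * A / δ := ⟨_, rfl⟩
  have hcpos : 0 < c := hc ▸ by positivity
  have hF0 : 0 ≤ F := (norm_nonneg _).trans (hF x (by simp))
  -- T is large enough that the telescoped loss, averaged over time, satisfies 2 c F / T ≤ δ / 4.
  obtain ⟨T, hT⟩ : ∃ T, T = 8 * c * (F + 1) / δ := ⟨_, rfl⟩
  have hTpos : 0 < T := hT ▸ by positivity
  -- The first bound keeps the energy growth (1 + ε h)^N below e < 4; the second makes the
  -- accumulated errors at most δ / 4.
  obtain ⟨ε, hεpos, hε1, hε2⟩ : ∃ ε > 0, ε * T ≤ 1 ∧ ε * (T + c) ≤ δ / 4 := by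
    refine ⟨min (1 / T) (δ / 4 / (T + c)), by positivity, ?_, ?_⟩
    · exact (le_div_iff₀ hTpos).1 (min_le_left _ _)
    · exact (le_div_iff₀ (by positivity)).1 (min_le_right _ _)
  obtain ⟨h₁, hh₁, H₁⟩ := exists_forall_metric_le hK hB hV hsymm hβ hcoer hLie hεpos
  obtain ⟨h₂, hh₂, H₂⟩ := exists_forall_comp_sub_smul_le hK hf hV.continuous hεpos
  obtain ⟨N, hN⟩ := exists_nat_gt (T / min h₁ h₂)
  have hmin : 0 < min h₁ h₂ := lt_min hh₁ hh₂
  have hNpos : (0 : ℝ) < N := lt_trans (by positivity) hN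
  obtain ⟨h, hh⟩ : ∃ h, h = T / N := ⟨_, rfl⟩
  have hpos : 0 < h := hh ▸ by positivity
  have hhmin : h ≤ min h₁ h₂ := by
    rw [hh, div_le_iff₀ hNpos, mul_comm]
    exact ((div_lt_iff₀ hmin).1 hN).le
  have hNh : N * h = T := by rw [hh]; field_simp
  have hpow : (1 + ε * h) ^ N ≤ 4 := by
    calc (1 + ε * h) ^ N ≤ Real.exp (ε * h) ^ N :=
          pow_le_pow_left₀ (by positivity) (by linarith [Real.add_one_le_exp (ε * h)]) N
      _ = Real.exp (ε * T) := by rw [← Real.exp_nat_mul, ← hNh]; ring_nf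
      _ ≤ Real.exp 1 := Real.exp_le_exp.2 hε1
      _ ≤ 4 := by linarith [Real.exp_one_lt_d9]
  obtain ⟨γ', H⟩ := exists_deriv_iterate_sub_smul hV hβ hcoer hVx y hA
    (a := ε * h) (by positivity) hpow
    (H₁ h ⟨hpos.le, hhmin.trans (min_le_left _ _)⟩)
  have hdesc := H₂ h ⟨hpos.le, hhmin.trans (min_le_right _ _)⟩
  set Φ : E → E := fun p => p - h • V p with hΦ
  set γ : ℕ → ℝ → E := fun k s => Φ^[k] (x + s • (y - x)) with hγ
  have hγsucc : ∀ k s, γ (k + 1) s = Φ (γ k s) := fun k s => Function.iterate_succ_apply' _ _ _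
  have hend : ∀ k ≤ N, f (γ k 1) ≤ f y + k * (h * ε) := by
    intro k
    induction k with
    | zero => simp [hγ]
    | succ k ih =>
      intro hk
      have h1 := ih (Nat.le_of_succ_le hk)
      have h2 := hdesc _ ((H k (Nat.le_of_succ_le hk)).2.2 1 ⟨zero_le_one, le_rfl⟩).1
      have h3 : 0 ≤ fderiv ℝ f (γ k 1) (V (γ k 1)) := by rw [hgrad]; exact hBnn _ _
      have h4 : h * (-(fderiv ℝ f (γ k 1) (V (γ k 1))) + ε) ≤ h * ε :=
        mul_le_mul_of_nonneg_left (by linarith) hpos.le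
      rw [hγsucc]
      push_cast
      change f (Φ (γ k 1)) ≤ f (γ k 1) + h * (-(fderiv ℝ f (γ k 1) (V (γ k 1))) + ε) at h2
      linarith
  -- Young's inequality, with c B(V, V) replaced by the decrease of f over one step, which
  -- telescopes in k.
  have hderiv : ∀ k < N, ∀ s ∈ Icc (0 : ℝ) 1, -(fderiv ℝ f (γ k s) (γ' k s))
      ≤ c / h * (f (γ k s) - f (γ (k + 1) s)) + (c * ε + δ / 4) := by
    intro k hk s hs
    obtain ⟨hm, hb⟩ := (H k hk.le).2.2 s hs
    have h1 := neg_apply_le_of_nonneg (hsymm (γ k s)) (hBnn (γ k s)) (V (γ k s)) (γ' k s) hcpos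
    have h2 := hdesc _ hm
    change f (Φ (γ k s)) ≤ f (γ k s) + h * (-(fderiv ℝ f (γ k s) (V (γ k s))) + ε) at h2
    rw [hgrad, ← hγsucc] at h2
    rw [hgrad]
    have h3 : B (γ k s) (γ' k s) (γ' k s) / (4 * c) ≤ δ / 4 := by
      rw [div_le_iff₀ (by positivity)]
      refine hb.trans (le_of_eq ?_)
      rw [hc]; field_simp
    have h4 : c * B (γ k s) (V (γ k s)) (V (γ k s))
        ≤ c / h * (f (γ k s) - f (γ (k + 1) s)) + c * ε := by
      have h5 : c / h * (h * B (γ k s) (V (γ k s)) (V (γ k s)))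
          ≤ c / h * (f (γ k s) - f (γ (k + 1) s) + h * ε) :=
        mul_le_mul_of_nonneg_left (by linarith) (by positivity)
      have h6 : c / h * (h * B (γ k s) (V (γ k s)) (V (γ k s)))
          = c * B (γ k s) (V (γ k s)) (V (γ k s)) := by field_simp
      have h7 : c / h * (f (γ k s) - f (γ (k + 1) s) + h * ε)
          = c / h * (f (γ k s) - f (γ (k + 1) s)) + c * ε := by field_simp
      linarith
    linarith
  have hS : ∀ s, HasDerivAt (fun s => -∑ k ∈ Finset.range N, f (γ k s))
      (-∑ k ∈ Finset.range N, fderiv ℝ f (γ k s) (γ' k s)) s := fun s =>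
    (HasDerivAt.fun_sum fun k hk =>
      (hf.differentiable one_ne_zero _).hasFDerivAt.comp_hasDerivAt s
        ((H k (Finset.mem_range.1 hk).le).2.1 s)).neg
  have hbound : ∀ s ∈ Icc (0 : ℝ) 1, -∑ k ∈ Finset.range N, fderiv ℝ f (γ k s) (γ' k s)
      ≤ c / h * (2 * F) + N * (c * ε + δ / 4) := by
    intro s hs
    have h0 := abs_le.1 (hF _ ((H 0 N.zero_le).2.2 s hs).1)
    have h1 := abs_le.1 (hF _ ((H N le_rfl).2.2 s hs).1)
    have h2 : c / h * (f (γ 0 s) - f (γ N s)) ≤ c / h * (2 * F) :=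
      mul_le_mul_of_nonneg_left (by linarith [h0.2, h1.1]) (by positivity)
    calc -∑ k ∈ Finset.range N, fderiv ℝ f (γ k s) (γ' k s)
        = ∑ k ∈ Finset.range N, -(fderiv ℝ f (γ k s) (γ' k s)) := by
          rw [Finset.sum_neg_distrib]
      _ ≤ ∑ k ∈ Finset.range N,
          (c / h * (f (γ k s) - f (γ (k + 1) s)) + (c * ε + δ / 4)) :=
          Finset.sum_le_sum fun k hk => hderiv k (Finset.mem_range.1 hk) s hs
      _ = c / h * (f (γ 0 s) - f (γ N s)) + N * (c * ε + δ / 4) := by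
          rw [Finset.sum_add_distrib, ← Finset.mul_sum,
            Finset.sum_range_sub' (fun k => f (γ k s)) N]
          simp only [Finset.sum_const, Finset.card_range, nsmul_eq_mul]
      _ ≤ _ := by linarith
  have key := (convex_Icc (0 : ℝ) 1).image_sub_le_mul_sub_of_deriv_le
    (fun t _ => (hS t).continuousAt.continuousWithinAt)
    (fun t _ => (hS t).differentiableAt.differentiableWithinAt)
    (fun t ht => by
      rw [(hS t).deriv]
      exact hbound t (interior_subset ht))
    0 ⟨le_rfl, zero_le_one⟩ 1 ⟨zero_le_one, le_rfl⟩ zero_le_one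
  have hS0 : ∑ k ∈ Finset.range N, f (γ k 0) = N * f x := by
    rw [Finset.sum_congr rfl (g := fun _ => f x) fun k hk => by
      simp only [hγ, zero_smul, add_zero, (H k (Finset.mem_range.1 hk).le).1]]
    simp
  have hS1 : ∑ k ∈ Finset.range N, f (γ k 1) ≤ N * (f y + T * ε) := by
    calc ∑ k ∈ Finset.range N, f (γ k 1) ≤ ∑ k ∈ Finset.range N, (f y + T * ε) :=
          Finset.sum_le_sum fun k hk => (hend k (Finset.mem_range.1 hk).le).trans (by
            have : (k : ℝ) ≤ N := Nat.cast_le.2 (Finset.mem_range.1 hk).le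
            have : k * (h * ε) ≤ N * (h * ε) :=
              mul_le_mul_of_nonneg_right this (by positivity)
            rw [← hNh]; linarith)
      _ = _ := by simp only [Finset.sum_const, Finset.card_range, nsmul_eq_mul]
  rw [hS0] at key
  have hch : c / h * (2 * F) ≤ N * (δ / 4) := by
    have h1 : c / h = N * (c / T) := by rw [hh]; field_simp
    have h2 : c / T * (2 * F) ≤ δ / 4 := by
      rw [hT, div_mul_eq_mul_div, div_le_iff₀ (by positivity)]
      have : δ / 4 * (8 * c * (F + 1) / δ) = 2 * c * (F + 1) := by field_simp; ring
      rw [this]; nlinarith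
    rw [h1, mul_assoc]
    exact mul_le_mul_of_nonneg_left h2 hNpos.le
  -- Together with `hε2` this yields δ ≤ 3δ / 4.
  have hfin : (N : ℝ) * δ ≤ N * (ε * (T + c) + δ / 2) := by
    have : (N : ℝ) * δ = N * f x - N * f y := by rw [hδ]; ring
    linarith
  have := le_of_mul_le_mul_left hfin hNpos
  linarith

end

/-! ### Smoothness of the inverse matrix. -/

theorem Matrix.contDiff_det {ι : Type*} [Fintype ι] [DecidableEq ι] {F : Type*}
    [NormedAddCommGroup F] [NormedSpace ℝ F] {k : WithTop ℕ∞} {M : F → Matrix ι ι ℝ}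
    (hM : ∀ i j, ContDiff ℝ k fun x => M x i j) : ContDiff ℝ k fun x => (M x).det := by
  simp only [Matrix.det_apply']
  exact ContDiff.sum fun σ _ => contDiff_const.mul (contDiff_prod fun i _ => hM _ _)

theorem Matrix.contDiff_inv {ι : Type*} [Fintype ι] [DecidableEq ι] {F : Type*}
    [NormedAddCommGroup F] [NormedSpace ℝ F] {k : WithTop ℕ∞} {M : F → Matrix ι ι ℝ}
    (hM : ∀ i j, ContDiff ℝ k fun x => M x i j) (hdet : ∀ x, (M x).det ≠ 0) (i j : ι) :
    ContDiff ℝ k fun x => (M x)⁻¹ i j := by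
  simp only [Matrix.inv_def, Ring.inverse_eq_inv', Matrix.smul_apply, smul_eq_mul,
    Matrix.adjugate_apply]
  refine ((Matrix.contDiff_det hM).inv hdet).mul (Matrix.contDiff_det fun a b => ?_)
  -- The adjugate entry is the determinant of a matrix whose row j is constant and whose other rows
  -- are those of M.
  by_cases h : a = j
  · subst h
    simpa using contDiff_const
  · simpa [h] using hM a b

/-! ### Metric, gradient and Hessian in coordinates. -/

namespace NatGradContraction

variable {n : ℕ}

theorem fderiv_apply_eq_sum_partialDeriv (g : EuclideanSpace ℝ (Fin n) → ℝ)
    (p v : EuclideanSpace ℝ (Fin n)) :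
    fderiv ℝ g p v = ∑ l, v l * partialDeriv l g p := by
  conv_lhs => rw [← (EuclideanSpace.basisFun (Fin n) ℝ).sum_repr v]
  simp [partialDeriv]

theorem contDiff_partialDeriv {g : EuclideanSpace ℝ (Fin n) → ℝ} {k m : WithTop ℕ∞}
    (hg : ContDiff ℝ k g) (hmk : m + 1 ≤ k) (i : Fin n) : ContDiff ℝ m (partialDeriv i g) :=
  (hg.fderiv_right hmk).clm_apply contDiff_const

/-- The `i`-th coordinate as a continuous linear functional. -/
noncomputable abbrev coordCLM (i : Fin n) : EuclideanSpace ℝ (Fin n) →L[ℝ] ℝ :=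
  EuclideanSpace.proj i

/-- The continuous bilinear form of a matrix. -/
noncomputable def bilin (M : Matrix (Fin n) (Fin n) ℝ) :
    EuclideanSpace ℝ (Fin n) →L[ℝ] EuclideanSpace ℝ (Fin n) →L[ℝ] ℝ :=
  ∑ i, ∑ j, M i j • (coordCLM i).smulRight
    (coordCLM j)

theorem bilin_apply (M : Matrix (Fin n) (Fin n) ℝ) (u w : EuclideanSpace ℝ (Fin n)) :
    bilin M u w = ∑ i, ∑ j, M i j * (u i * w j) := by
  simp [bilin, _root_.sum_apply]

set_option maxSynthPendingDepth 6 in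
theorem contDiff_bilin {M : EuclideanSpace ℝ (Fin n) → Matrix (Fin n) (Fin n) ℝ}
    {k : WithTop ℕ∞} (hM : ∀ i j, ContDiff ℝ k fun x => M x i j) :
    ContDiff ℝ k fun x => bilin (M x) :=
  ContDiff.sum fun i _ => ContDiff.sum fun j _ => (hM i j).smul contDiff_const

set_option maxSynthPendingDepth 6 in
theorem fderiv_bilin_apply {M : EuclideanSpace ℝ (Fin n) → Matrix (Fin n) (Fin n) ℝ}
    (hM : ∀ i j, ContDiff ℝ 1 fun x => M x i j) (p v u w : EuclideanSpace ℝ (Fin n)) :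
    fderiv ℝ (fun x => bilin (M x)) p v u w
      = ∑ i, ∑ j, (∑ l, v l * partialDeriv l (fun x => M x i j) p) * (u i * w j) := by
  have h1 : HasFDerivAt (fun x => bilin (M x) u w)
      (∑ i, ∑ j, (u i * w j) • fderiv ℝ (fun x => M x i j) p) p := by
    simp only [bilin_apply]
    exact HasFDerivAt.fun_sum fun i _ => HasFDerivAt.fun_sum fun j _ =>
      ((hM i j).differentiable one_ne_zero p).hasFDerivAt.mul_const _
  have h2 := (((contDiff_bilin hM).differentiable one_ne_zero p).hasFDerivAt.clm_apply
    (hasFDerivAt_const u p)).clm_apply (hasFDerivAt_const w p)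
  have h3 := congrArg (fun L => L v) (h2.unique h1)
  simp [_root_.sum_apply, fderiv_apply_eq_sum_partialDeriv] at h3
  rw [h3]
  exact Finset.sum_congr rfl fun i _ => Finset.sum_congr rfl fun j _ => mul_comm _ _

/-- The gradient of `f` in the metric `M`. -/
noncomputable def riemannianGradient (M : EuclideanSpace ℝ (Fin n) → Matrix (Fin n) (Fin n) ℝ)
    (f : EuclideanSpace ℝ (Fin n) → ℝ) (p : EuclideanSpace ℝ (Fin n)) :
    EuclideanSpace ℝ (Fin n) :=
  WithLp.toLp 2 fun i => ∑ k, (M p)⁻¹ i k * partialDeriv k f p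

theorem contDiff_riemannianGradient {M : EuclideanSpace ℝ (Fin n) → Matrix (Fin n) (Fin n) ℝ}
    {f : EuclideanSpace ℝ (Fin n) → ℝ} (hM : ∀ i j, ContDiff ℝ 1 fun x => M x i j)
    (hdet : ∀ x, (M x).det ≠ 0) (hf : ContDiff ℝ 2 f) : ContDiff ℝ 1 (riemannianGradient M f) := by
  rw [contDiff_euclidean]
  intro i
  change ContDiff ℝ 1 fun x => ∑ k, (M x)⁻¹ i k * partialDeriv k f x
  exact ContDiff.sum fun k _ => (Matrix.contDiff_inv hM hdet i k).mul
    (contDiff_partialDeriv hf (by norm_num) k)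

theorem sum_mul_riemannianGradient {M : EuclideanSpace ℝ (Fin n) → Matrix (Fin n) (Fin n) ℝ}
    (f : EuclideanSpace ℝ (Fin n) → ℝ) {p : EuclideanSpace ℝ (Fin n)}
    (hdet : (M p).det ≠ 0) (i : Fin n) :
    ∑ k, M p i k * riemannianGradient M f p k = partialDeriv i f p := by
  have h : (M p).mulVec ((M p)⁻¹.mulVec fun k => partialDeriv k f p) = fun k => partialDeriv k f p := by
    rw [Matrix.mulVec_mulVec, Matrix.mul_nonsing_inv _ (isUnit_iff_ne_zero.2 hdet),
      Matrix.one_mulVec]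
  exact congrFun h i

/-- The product rule applied to ∂ⱼf = ∑ₖ Mⱼₖ Vₖ, which avoids differentiating the inverse matrix. -/
theorem partialDeriv_partialDeriv_eq {M : EuclideanSpace ℝ (Fin n) → Matrix (Fin n) (Fin n) ℝ}
    {f : EuclideanSpace ℝ (Fin n) → ℝ} (hM : ∀ i j, ContDiff ℝ 1 fun x => M x i j)
    (hdet : ∀ x, (M x).det ≠ 0) (hf : ContDiff ℝ 2 f) (p : EuclideanSpace ℝ (Fin n))
    (i j : Fin n) :
    partialDeriv i (partialDeriv j f) p
      = ∑ k, (M p j k * partialDeriv i (fun x => riemannianGradient M f x k) p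
        + riemannianGradient M f p k * partialDeriv i (fun x => M x j k) p) := by
  have hV := contDiff_euclidean.1 (contDiff_riemannianGradient hM hdet hf)
  have h1 : HasFDerivAt (fun x => ∑ k, M x j k * riemannianGradient M f x k)
      (∑ k, (M p j k • fderiv ℝ (fun x => riemannianGradient M f x k) p
        + riemannianGradient M f p k • fderiv ℝ (fun x => M x j k) p)) p :=
    HasFDerivAt.fun_sum fun k _ =>
      ((hM j k).differentiable one_ne_zero p).hasFDerivAt.mul
        ((hV k).differentiable one_ne_zero p).hasFDerivAt
  rw [funext fun x => sum_mul_riemannianGradient f (hdet x) j] at h1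
  have h2 := congrArg (fun L => L (EuclideanSpace.single i 1)) h1.fderiv
  simpa [_root_.sum_apply, partialDeriv] using h2

theorem sum_christoffel_mul_partialDeriv
    {M : EuclideanSpace ℝ (Fin n) → Matrix (Fin n) (Fin n) ℝ}
    (f : EuclideanSpace ℝ (Fin n) → ℝ) {p : EuclideanSpace ℝ (Fin n)} (hs : (M p).IsSymm)
    (i j : Fin n) :
    ∑ k, christoffel M k i j p * partialDeriv k f p
      = (1 / 2 : ℝ) * ∑ l, riemannianGradient M f p l *
        (partialDeriv j (fun y => M y i l) p + partialDeriv i (fun y => M y j l) p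
          - partialDeriv l (fun y => M y i j) p) := by
  have hinv : ∀ a b, (M p)⁻¹ a b = (M p)⁻¹ b a := fun a b => by
    conv_lhs => rw [← hs.eq, ← Matrix.transpose_nonsing_inv, Matrix.transpose_apply]
  simp only [christoffel, riemannianGradient, Finset.mul_sum, Finset.sum_mul]
  rw [Finset.sum_comm]
  refine Finset.sum_congr rfl fun l _ => Finset.sum_congr rfl fun k _ => ?_
  rw [hinv k l]; ring

/-- In the quadratic form, the first two Christoffel terms agree after swapping i and j and cancel
the V ∂M term of the second derivatives of f. The third leaves half the derivative of B along V. -/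
theorem two_mul_riemannianHessian_apply
    {M : EuclideanSpace ℝ (Fin n) → Matrix (Fin n) (Fin n) ℝ}
    {f : EuclideanSpace ℝ (Fin n) → ℝ} (hM : ∀ i j, ContDiff ℝ 1 fun x => M x i j)
    (hdet : ∀ x, (M x).det ≠ 0) (hs : ∀ x, (M x).IsSymm) (hf : ContDiff ℝ 2 f)
    (p w : EuclideanSpace ℝ (Fin n)) :
    2 * ∑ i, ∑ j, w i * w j * riemannianHessian M f p i j
      = 2 * bilin (M p) w (fderiv ℝ (riemannianGradient M f) p w)
        + fderiv ℝ (fun x => bilin (M x)) p (riemannianGradient M f p) w w := by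
  have hV := contDiff_riemannianGradient hM hdet hf
  have hVw : ∀ j, fderiv ℝ (riemannianGradient M f) p w j
      = ∑ l, w l * partialDeriv l (fun x => riemannianGradient M f x j) p := fun j => by
    rw [← fderiv_apply_eq_sum_partialDeriv]
    have h1 := (coordCLM j).hasFDerivAt.comp p
      (hV.differentiable one_ne_zero p).hasFDerivAt
    exact (congrArg (fun L => L w) h1.fderiv).symm
  rw [fderiv_bilin_apply hM, bilin_apply]
  simp only [hVw, riemannianHessian, Matrix.of_apply, partialDeriv_partialDeriv_eq hM hdet hf,
    sum_christoffel_mul_partialDeriv f (hs p)]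
  set v := riemannianGradient M f p
  have hsw : ∀ g : Fin n → Fin n → ℝ, ∑ i, ∑ j, w i * w j * g i j = ∑ i, ∑ j, w i * w j * g j i :=
    fun g => by
      rw [Finset.sum_comm]
      exact Finset.sum_congr rfl fun i _ => Finset.sum_congr rfl fun j _ => by ring
  have e1 : ∑ i, ∑ j, M p i j * (w i * ∑ l, w l *
        partialDeriv l (fun x => riemannianGradient M f x j) p)
      = ∑ i, ∑ j, w i * w j *
        ∑ k, M p j k * partialDeriv i (fun x => riemannianGradient M f x k) p := by
    rw [hsw]
    refine Finset.sum_congr rfl fun i _ => ?_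
    simp only [Finset.mul_sum]
    rw [Finset.sum_comm]
    exact Finset.sum_congr rfl fun j _ => Finset.sum_congr rfl fun k _ => by ring
  have e2 := hsw fun i j => ∑ k, v k * partialDeriv i (fun x => M x j k) p
  have e3 : ∑ i, ∑ j, (∑ l, v l * partialDeriv l (fun x => M x i j) p) * (w i * w j)
      = ∑ i, ∑ j, w i * w j * ∑ l, v l * partialDeriv l (fun x => M x i j) p :=
    Finset.sum_congr rfl fun i _ => Finset.sum_congr rfl fun j _ => mul_comm _ _
  rw [e1, e3]
  simp only [mul_add, mul_sub, Finset.sum_add_distrib, Finset.sum_sub_distrib] at e2 ⊢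
  have e4 : ∀ g : Fin n → Fin n → ℝ, ∑ i, ∑ j, w i * w j * (1 / 2 * g i j)
      = 1 / 2 * ∑ i, ∑ j, w i * w j * g i j := fun g => by
    simp only [Finset.mul_sum]
    exact Finset.sum_congr rfl fun i _ => Finset.sum_congr rfl fun j _ => by ring
  rw [e4, e4, e4]
  linarith

end NatGradContraction

/-! ### Application to the Riemannian gradient. -/

theorem theorem2 (n : ℕ) (f : EuclideanSpace ℝ (Fin n) → ℝ)
    (M : EuclideanSpace ℝ (Fin n) → Matrix (Fin n) (Fin n) ℝ)
    (hf : ContDiff ℝ 2 f)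
    (hM : ∀ i j : Fin n, ContDiff ℝ 1 (fun x => M x i j))
    (hMpos : NatGradContraction.IsUniformlyPosDef M)
    (hH : ∀ x, (NatGradContraction.riemannianHessian M f x).PosSemidef)
    (x : EuclideanSpace ℝ (Fin n)) (hx : NatGradContraction.IsStationaryPoint f x) :
    ∀ y : EuclideanSpace ℝ (Fin n), f x ≤ f y := by
  obtain ⟨hs, β, hβ, hpos⟩ := hMpos
  have hquad : ∀ (A : Matrix (Fin n) (Fin n) ℝ) (w : EuclideanSpace ℝ (Fin n)),
      star (w : Fin n → ℝ) ⬝ᵥ A.mulVec w = ∑ i, ∑ j, w i * w j * A i j := fun A w => by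
    simp only [dotProduct, Matrix.mulVec, Finset.mul_sum]
    exact Finset.sum_congr rfl fun i _ => Finset.sum_congr rfl fun j _ => by simp; ring
  -- M is the sum of the positive semidefinite M - βI and the positive definite βI.
  have hdet : ∀ p, (M p).det ≠ 0 := fun p => by
    have h1 : (M p).PosDef := by
      have := Matrix.PosDef.posSemidef_add (hpos p) ((Matrix.PosDef.one (n := Fin n) (R := ℝ)).smul hβ)
      simpa using this
    exact h1.det_pos.ne'
  have hcoer : ∀ p w, β * ‖w‖ ^ 2 ≤ NatGradContraction.bilin (M p) w w := fun p w => by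
    have h1 := (hpos p).dotProduct_mulVec_nonneg w
    rw [Matrix.sub_mulVec, dotProduct_sub, hquad] at h1
    have h2 : star (w : Fin n → ℝ) ⬝ᵥ (β • (1 : Matrix (Fin n) (Fin n) ℝ)).mulVec w
        = β * ‖w‖ ^ 2 := by
      rw [EuclideanSpace.real_norm_sq_eq, Matrix.smul_mulVec, Matrix.one_mulVec, dotProduct_smul]
      simp [dotProduct, sq]
    rw [h2] at h1
    simp only [NatGradContraction.bilin_apply, mul_comm (M p _ _)]
    linarith
  refine le_of_fderiv_eq_zero_of_lieDeriv_nonneg (NatGradContraction.contDiff_bilin hM)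
    (NatGradContraction.contDiff_riemannianGradient hM hdet hf) (hf.of_le one_le_two) (fun p u w => ?_) hβ hcoer
    (fun p w => ?_) (fun p w => ?_) ?_
  · rw [NatGradContraction.bilin_apply, NatGradContraction.bilin_apply, Finset.sum_comm]
    exact Finset.sum_congr rfl fun i _ => Finset.sum_congr rfl fun j _ => by
      rw [(hs p).apply]; ring
  · rw [NatGradContraction.fderiv_apply_eq_sum_partialDeriv, NatGradContraction.bilin_apply, Finset.sum_comm]
    refine Finset.sum_congr rfl fun l _ => ?_
    rw [← NatGradContraction.sum_mul_riemannianGradient f (hdet p), Finset.mul_sum]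
    exact Finset.sum_congr rfl fun i _ => by rw [(hs p).apply]; ring
  · rw [← NatGradContraction.two_mul_riemannianHessian_apply hM hdet hs hf, ← hquad]
    exact mul_nonneg zero_le_two ((hH p).dotProduct_mulVec_nonneg w)
  · ext w
    simp [NatGradContraction.fderiv_apply_eq_sum_partialDeriv, hx _]
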